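/- Let $f:\mathbb R^n\to\mathbb R$ be convex and continuously differentiable, let $g:\mathbb R^m\to\mathbb R\cup\{+\infty\}$ be proper, lower semicontinuous (lsc) and convex, and let $c:\mathbb R^n\to\mathbb R^m$ be continuously differentiable and $(-\operatorname{hzn} g)$-convex, that is, $$c(\lambda x+(1-\lambda)x')-\lambda c(x)-(1-\lambda)c(x')\in\operatorname{hzn}g:=\{v\in\mathbb R^m \mid g(z+v)\le g(z)\ \text{for all } z\in\operatorname{dom}g\}$$ for all $x,x'\in\mathbb R^n$ and $\lambda\in[0,1]$. Consider the problem (P) $\quad$ minimize $\Phi(x):=f(x)+g(c(x))$ over $x\in\mathbb R^n$. Assume that (P) is feasible (that is, $c(x)\in\operatorname{dom}g$ for some $x$) and possesses a minimizer, and let $\Phi^*$ be its minimal value. Call a feasible point $\bar x$ stationary if there is $\bar y\in\mathbb R^m$ with $\nabla f(\bar x)+c'(\bar x)^\top\bar y=0$ and $c(\bar x)\in\partial g^*(\bar y)$ (equivalently, $\bar y\in\partial g(c(\bar x))$). For $\mu>0$ let $$\mathcal L_\mu(x,y):=f(x)+\inf_{z\in\mathbb R^m}\Big\{g(z)+\langle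 y,c(x)-z\rangle+\tfrac1{2\mu}\|c(x)-z\|^2\Big\}$$ be the augmented Lagrangian, and let $\operatorname{prox}_{\mu g}(w)$ be the unique minimizer of $z\mapsto g(z)+\frac1{2\mu}\|z-w\|^2$. Let $\Pi_C$ denote the Euclidean projection onto a nonempty, closed, convex set $C$. **Algorithm (safeguarded augmented Lagrangian method with elastic safeguard).** Data: $y^0\in\mathbb R^m$, $\mu_0>0$, a nonempty, convex, compact set $Y_{\rm sg}\subseteq\mathbb R^m$, $\theta,\eta\in(0,1)$ and $\beta\in(\eta^2,\eta)$. Set $\rho_0:=1$ and $V^{-1}:=\infty$. For $k=0,1,2,\dots$: 1. set $\hat y^k:=\Pi_{\rho_kY_{\rm sg}}(y^k)$; 2. select $\varepsilon_k\ge0$ and compute $x^k\in\mathbb R^n$ with $\mathcal L_{\mu_k}(x^k,\hat y^k)\le\inf_{x}\mathcal L_{\mu_k}(x,\hat y^k)+\varepsilon_k$; 3. set $z^k:=\operatorname{prox}_{\mu_kg}(c(x^k)+\mu_k\hat y^k)$ and $V^k:=\|c(x^k)-z^k\|_\infty$; 4. set $y^{k+1}:=\hat y^k+\mu_k^{-1}[c(x^k)-z^k]$;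 5. if $V^k\le\theta V^{k-1}$, set $\mu_{k+1}:=\mu_k$ and $\rho_{k+1}:=\rho_k$; otherwise set $\mu_{k+1}:=\beta\mu_k$ and $\rho_{k+1}:=(\eta/\beta)\rho_k$. **Theorem 6.3.** In this setting, suppose that no minimizer of (P) is stationary, and that the value function $\mathcal V(u):=\inf_{x\in\mathbb R^n}\{f(x)+g(c(x)-u)\}$, $u\in\mathbb R^m$, is proper and lsc. Let $\{(x^k,z^k,y^k,\hat y^k)\}$ be generated by the algorithm in such a way that $\sum_{k=0}^\infty\sqrt{\varepsilon_k/\mu_k}<\infty$. Then $$\|y^k\|\to\infty\qquad\text{and}\qquad\limsup_{k\to\infty}\big(f(x^k)+g(z^k)\big)\le\Phi^*.$$ Moreover, each accumulation point of $\{x^k\}$ is a minimizer of (P), and for each subsequence $\{x^k\}_{k\in K}$ converging to some $\bar x$, one has $z^k\to c(\bar x)$ and $f(x^k)+g(z^k)\to\Phi^*$ as $k\to\infty$, $k\in K$. -/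

import Mathlib

open Filter Topology
open scoped Pointwise

namespace ConvexComposite

/-- The Euclidean space `ℝ^d` with its Euclidean norm and inner product. -/
abbrev Eu (d : ℕ) : Type := EuclideanSpace ℝ (Fin d)

/-! Extended-real-valued functions -/

/-- `φ` is proper: its domain `{z | φ z < ∞}` is nonempty, and `φ` never takes the value `-∞`. -/
def Proper {d : ℕ} (φ : Eu d → EReal) : Prop :=
  (∃ z, φ z < ⊤) ∧ ∀ z, φ z ≠ ⊥

/-- `φ` is convex: its epigraph is a convex set. -/
def ConvexFun {d : ℕ} (φ : Eu d → EReal) : Prop :=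
  Convex ℝ {p : Eu d × ℝ | φ p.1 ≤ (p.2 : EReal)}

/-- The conjugate `φ*(y) = sup_z (⟨z, y⟩ - φ z)`. -/
noncomputable def conj {d : ℕ} (φ : Eu d → EReal) (y : Eu d) : EReal :=
  ⨆ z : Eu d, (((inner ℝ z y : ℝ) : EReal) - φ z)

/-- The subdifferential of convex analysis at a point where `φ` is finite
(it is empty at the other points). -/
def subdiff {d : ℕ} (φ : Eu d → EReal) (zbar : Eu d) : Set (Eu d) :=
  {y | φ zbar ≠ ⊤ ∧ φ zbar ≠ ⊥ ∧
    ∀ z, φ zbar + ((inner ℝ y (z - zbar) : ℝ) : EReal) ≤ φ z}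

/-- The horizon of `φ`: all `v` with `φ (z + v) ≤ φ z` for each `z ∈ dom φ`. -/
def hzn {d : ℕ} (φ : Eu d → EReal) : Set (Eu d) :=
  {v | ∀ z, φ z < ⊤ → φ (z + v) ≤ φ z}

/-- `w = prox_{γ φ}(z)`: the point `w` minimizes `φ + ‖· - z‖² / (2 γ)`. For proper, lsc, convex
`φ` and `γ > 0` there is exactly one such `w`. -/
def IsProx {d : ℕ} (γ : ℝ) (φ : Eu d → EReal) (z w : Eu d) : Prop :=
  ∀ w', φ w + ((‖w - z‖ ^ 2 / (2 * γ) : ℝ) : EReal) ≤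
    φ w' + ((‖w' - z‖ ^ 2 / (2 * γ) : ℝ) : EReal)

/-- `p` is the projection of `y` onto `C`: a point of `C` nearest to `y`. For nonempty, closed,
convex `C` there is exactly one such `p`. -/
def IsProjection {d : ℕ} (C : Set (Eu d)) (y p : Eu d) : Prop :=
  p ∈ C ∧ ∀ q ∈ C, ‖p - y‖ ≤ ‖q - y‖

/-- The maximum norm of a vector. -/
noncomputable def maxNorm {d : ℕ} (v : Eu d) : ℝ := ‖WithLp.ofLp v‖

/-! The composite problem: minimize `f x + g (c x)` over `x` -/

/-- The data `f`, `g`, `c` of a composite problem. -/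
structure Problem (n m : ℕ) where
  f : Eu n → ℝ
  g : Eu m → EReal
  c : Eu n → Eu m

namespace Problem

variable {n m : ℕ} (P : Problem n m)

/-- The objective `Φ x = f x + g (c x)`. -/
noncomputable def obj (x : Eu n) : EReal := (P.f x : EReal) + P.g (P.c x)

/-- `x` is a (global) minimizer. -/
def IsMinimizer (x : Eu n) : Prop := ∀ x', P.obj x ≤ P.obj x'

/-- The minimal value `Φ*`. -/
noncomputable def optVal : EReal := ⨅ x : Eu n, P.obj x

/-- The standing assumptions on the fully convex composite problem. -/
structure StandingAssumptions : Prop where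
  f_smooth : ContDiff ℝ 1 P.f
  f_convex : ConvexOn ℝ Set.univ P.f
  g_proper : Proper P.g
  g_lsc : LowerSemicontinuous P.g
  g_convex : ConvexFun P.g
  c_smooth : ContDiff ℝ 1 P.c
  c_convex : ∀ x x' : Eu n, ∀ t : ℝ, 0 ≤ t → t ≤ 1 →
    P.c (t • x + (1 - t) • x') - t • P.c x - (1 - t) • P.c x' ∈ hzn P.g
  feasible : ∃ x, P.g (P.c x) < ⊤
  exists_minimizer : ∃ x, P.IsMinimizer x

/-- `x` is stationary: it is feasible, and there is `y` with `∇ₓ L(x, y) = 0` and `c x ∈ ∂g*(y)`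
for the Lagrangian `L(x, y) = f x + ⟨y, c x⟩ - g*(y)`; the last term does not depend on `x` (and
is finite by the second condition), so that it is left out of the `x`-gradient. -/
def IsStationary (x : Eu n) : Prop :=
  P.g (P.c x) < ⊤ ∧ ∃ y : Eu m,
    HasGradientAt (fun x' : Eu n => P.f x' + inner ℝ y (P.c x')) 0 x ∧
    P.c x ∈ subdiff (conj P.g) y

/-- The value function `u ↦ inf_x (f x + g (c x - u))`. -/
noncomputable def valueFun (u : Eu m) : EReal :=
  ⨅ x : Eu n, ((P.f x : EReal) + P.g (P.c x - u))

/-- The augmented Lagrangian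
`L_μ(x, y) = f x + inf_z (g z + ⟨y, c x - z⟩ + ‖c x - z‖² / (2 μ))`. -/
noncomputable def augLag (μ : ℝ) (x : Eu n) (y : Eu m) : EReal :=
  (P.f x : EReal) + ⨅ z : Eu m,
    (P.g z + ((inner ℝ y (P.c x - z) + ‖P.c x - z‖ ^ 2 / (2 * μ) : ℝ) : EReal))

end Problem

/-- The residual of the preceding iteration, which is `∞` for the initial iteration. -/
noncomputable def prevResidual (V : ℕ → ℝ) : ℕ → EReal
  | 0 => ⊤
  | k + 1 => (V k : EReal)

/-- The parameters of the safeguarded augmented Lagrangian method with elastic safeguard. -/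
structure ElasticParams (m : ℕ) where
  y0 : Eu m
  μ0 : ℝ
  Ysg : Set (Eu m)
  θ : ℝ
  η : ℝ
  β : ℝ
  μ0_pos : 0 < μ0
  Ysg_nonempty : Ysg.Nonempty
  Ysg_convex : Convex ℝ Ysg
  Ysg_compact : IsCompact Ysg
  θ_mem : θ ∈ Set.Ioo (0 : ℝ) 1
  η_mem : η ∈ Set.Ioo (0 : ℝ) 1
  β_mem : β ∈ Set.Ioo (η ^ 2) η

/-- The sequences are generated by the safeguarded augmented Lagrangian method with elastic
safeguard, run with parameters `D` on the problem `P`: `μ` are the penalty parameters, `ρ` the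
scaling factors of the safeguarding set, `ε` the tolerances of the subproblems. -/
structure IsElasticALM {n m : ℕ} (P : Problem n m) (D : ElasticParams m)
    (x : ℕ → Eu n) (z y yhat : ℕ → Eu m) (μ ρ ε : ℕ → ℝ) : Prop where
  y_zero : y 0 = D.y0
  μ_zero : μ 0 = D.μ0
  ρ_zero : ρ 0 = 1
  yhat_eq : ∀ k, IsProjection (ρ k • D.Ysg) (y k) (yhat k)
  ε_nonneg : ∀ k, 0 ≤ ε k
  x_approx : ∀ k, P.augLag (μ k) (x k) (yhat k) ≤
    (⨅ x' : Eu n, P.augLag (μ k) x' (yhat k)) + (ε k : EReal)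
  z_eq : ∀ k, IsProx (μ k) P.g (P.c (x k) + μ k • yhat k) (z k)
  y_succ : ∀ k, y (k + 1) = yhat k + (μ k)⁻¹ • (P.c (x k) - z k)
  update_keep : ∀ k,
    (maxNorm (P.c (x k) - z k) : EReal) ≤
        (D.θ : EReal) * prevResidual (fun j => maxNorm (P.c (x j) - z j)) k →
      μ (k + 1) = μ k ∧ ρ (k + 1) = ρ k
  update_shrink : ∀ k,
    ¬ (maxNorm (P.c (x k) - z k) : EReal) ≤
        (D.θ : EReal) * prevResidual (fun j => maxNorm (P.c (x j) - z j)) k →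
      μ (k + 1) = D.β * μ k ∧ ρ (k + 1) = D.η / D.β * ρ k

end ConvexComposite

/-! Write `u = c x - z` for the residual. As the curvature defect of `c` lies in `hzn g`, the
function `f x + g (c x - u)` is jointly convex in `(x, u)`. Its infimum over `x` is the value
function, which equals `Φ*` at `0`, and approximate optimality of step `k` makes `-y (k + 1)` an
approximate subgradient of it at the current residual, with error governed by `√(ε k / μ k)`
(`splitVal_le`). If along some subsequence the residuals vanish and the multipliers converge, lower
semicontinuity at `0` carries the inequality to the limit, and the limit multiplier makes a
minimizer stationary. This is excluded (`not_tendsto_multiplier`).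

The exclusion is used twice. If the penalty shrank only finitely often, residuals would decay
geometrically with `μ` and `ρ` frozen, so the multipliers would be bounded and cluster. Hence it
shrinks infinitely often, each time multiplying `μ ρ²` by `η² / β < 1`. Since `‖yhat‖ ≤ R ρ`, it
follows that `μ ‖yhat‖² → 0`, which forces the residuals to `0` and the values `f x + g z` of the
whole sequence to `Φ*`. With vanishing residuals, the second use rules out any bounded subsequence
of multipliers. Accumulation points are optimal by lower semicontinuity of `g`. -/

namespace ConvexComposite

variable {n m : ℕ}

/-! ### Real-variable estimates -/

/-- First-order consequence of approximate optimality along a segment: test the hypothesis at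
`t = μ * s` and divide by `t`. -/
theorem le_of_segment_bound {F v a b μ ε s : ℝ} (hμ : 0 < μ) (hs : 0 < s) (hμs : μ * s ≤ 1)
    (hε : ε ≤ μ * s ^ 2)
    (h : ∀ t : ℝ, 0 ≤ t → t ≤ 1 → F ≤ t * v + (1 - t) * F + t * a + t ^ 2 * b / (2 * μ) + ε) :
    F ≤ v + a + s * (b / 2 + 1) := by
  have h1 := h (μ * s) (by positivity) hμs
  have h2 : (μ * s) ^ 2 * b / (2 * μ) = μ * s * (s * b / 2) := by field_simp
  rw [h2] at h1
  have h3 : μ * s * F ≤ μ * s * (v + a + s * (b / 2 + 1)) := by nlinarith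
  exact le_of_mul_le_mul_left h3 (by positivity)

/-- A monotone limit `L ≥ 0` exists, and the contraction, holding infinitely often, gives `L ≤ r L`.
-/
theorem tendsto_zero_of_antitone_of_frequently_mul {q : ℕ → ℝ} {r : ℝ} (hq : ∀ k, 0 ≤ q k)
    (hr : r < 1) (hanti : Antitone q) (hfreq : ∃ᶠ k in atTop, q (k + 1) ≤ r * q k) :
    Tendsto q atTop (𝓝 0) := by
  obtain ⟨L, hL⟩ : ∃ L, Tendsto q atTop (𝓝 L) :=
    ⟨_, tendsto_atTop_ciInf hanti ⟨0, by rintro _ ⟨k, rfl⟩; exact hq k⟩⟩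
  have hL0 : 0 ≤ L := ge_of_tendsto' hL hq
  have h1 : L ≤ r * L :=
    le_of_tendsto_of_tendsto_of_frequently ((tendsto_add_atTop_iff_nat 1).2 hL)
      (hL.const_mul r) hfreq
  have : L = 0 := by nlinarith
  rwa [this] at hL

theorem tendsto_zero_of_tendsto_maxNorm {ι : Type*} {l : Filter ι} {u : ι → Eu m}
    (h : Tendsto (fun i => maxNorm (u i)) l (𝓝 0)) : Tendsto u l (𝓝 0) := by
  have h1 : Tendsto (fun i => WithLp.ofLp (u i)) l (𝓝 0) :=
    tendsto_zero_iff_norm_tendsto_zero.2 h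
  have h2 := ((PiLp.continuous_toLp 2 (fun _ : Fin m => ℝ)).tendsto 0).comp h1
  simpa [Function.comp_def] using h2

/-! ### Real-valued form of convexity and proximal inequalities -/

theorem Proper.coe_toReal {φ : Eu m → EReal} (h : Proper φ) {z : Eu m} (hz : φ z < ⊤) :
    ((φ z).toReal : EReal) = φ z :=
  EReal.coe_toReal hz.ne (h.2 z)

theorem ConvexFun.le_combo {φ : Eu m → EReal} (hc : ConvexFun φ) (hp : Proper φ) {z z' : Eu m}
    (hz : φ z < ⊤) (hz' : φ z' < ⊤) {t : ℝ} (h0 : 0 ≤ t) (h1 : t ≤ 1) :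
    φ (t • z + (1 - t) • z') ≤ ((t * (φ z).toReal + (1 - t) * (φ z').toReal : ℝ) : EReal) := by
  have := hc (x := (z, (φ z).toReal)) (by simp [hp.coe_toReal hz])
    (y := (z', (φ z').toReal)) (by simp [hp.coe_toReal hz']) h0 (sub_nonneg.2 h1) (by ring)
  simpa using this

theorem IsProx.lt_top {φ : Eu m → EReal} (hp : Proper φ) {γ : ℝ} {z w : Eu m}
    (h : IsProx γ φ z w) : φ w < ⊤ := by
  obtain ⟨w', hw'⟩ := hp.1
  have h1 := h w'
  rw [← hp.coe_toReal hw', ← EReal.coe_add] at h1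
  by_contra hw
  rw [not_lt, top_le_iff] at hw
  rw [hw, EReal.top_add_coe, top_le_iff] at h1
  exact EReal.coe_ne_top _ h1

theorem IsProx.toReal_le {φ : Eu m → EReal} (hp : Proper φ) {γ : ℝ} {z w w' : Eu m}
    (h : IsProx γ φ z w) (hw' : φ w' < ⊤) :
    (φ w).toReal + ‖w - z‖ ^ 2 / (2 * γ) ≤ (φ w').toReal + ‖w' - z‖ ^ 2 / (2 * γ) := by
  have h1 := h w'
  rw [← hp.coe_toReal hw', ← hp.coe_toReal (h.lt_top hp)] at h1
  exact_mod_cast h1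

/-! ### The joint problem in `(x, z)` and the value function -/

namespace Problem

variable (P : Problem n m)

/-- The finite value `f x + g z`, meaningful when `z ∈ dom g`. -/
noncomputable def splitVal (x : Eu n) (z : Eu m) : ℝ := P.f x + (P.g z).toReal

/-- The augmented Lagrangian term to be minimized jointly over `(x, z)`. -/
noncomputable def splitLag (μ : ℝ) (y : Eu m) (x : Eu n) (z : Eu m) : ℝ :=
  P.splitVal x z + inner ℝ y (P.c x - z) + ‖P.c x - z‖ ^ 2 / (2 * μ)

variable {P}

theorem StandingAssumptions.coe_splitVal (hP : P.StandingAssumptions) (x : Eu n) {z : Eu m}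
    (hz : P.g z < ⊤) : (P.splitVal x z : EReal) = P.f x + P.g z := by
  rw [splitVal, EReal.coe_add, hP.g_proper.coe_toReal hz]

theorem StandingAssumptions.augLag_le (hP : P.StandingAssumptions) (μ : ℝ) (x : Eu n) (y : Eu m)
    {z : Eu m} (hz : P.g z < ⊤) : P.augLag μ x y ≤ (P.splitLag μ y x z : EReal) := by
  refine (add_le_add_right (iInf_le _ z) _).trans_eq ?_
  rw [← hP.g_proper.coe_toReal hz, ← EReal.coe_add, ← EReal.coe_add]
  simp only [splitLag, splitVal, add_assoc]

/-- Completing the square: the proximal objective and the inner objective of the augmented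
Lagrangian differ by a constant in `z`, so they have the same minimizers. -/
theorem norm_sub_sq_div_eq {μ : ℝ} (hμ : 0 < μ) (c y z : Eu m) :
    ‖z - (c + μ • y)‖ ^ 2 / (2 * μ) =
      inner ℝ y (c - z) + ‖c - z‖ ^ 2 / (2 * μ) + μ * ‖y‖ ^ 2 / 2 := by
  have h : z - (c + μ • y) = -((c - z) + μ • y) := by abel
  rw [h, norm_neg, norm_add_sq_real, inner_smul_right, norm_smul, Real.norm_of_nonneg hμ.le,
    real_inner_comm]
  field_simp
  ring

theorem StandingAssumptions.le_augLag (hP : P.StandingAssumptions) {μ : ℝ} (hμ : 0 < μ)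
    (x : Eu n) (y : Eu m) {z : Eu m} (hz : IsProx μ P.g (P.c x + μ • y) z) :
    (P.splitLag μ y x z : EReal) ≤ P.augLag μ x y := by
  have hzt := hz.lt_top hP.g_proper
  have : (((P.g z).toReal + (inner ℝ y (P.c x - z) + ‖P.c x - z‖ ^ 2 / (2 * μ)) : ℝ) : EReal) ≤
      ⨅ w : Eu m, (P.g w + ((inner ℝ y (P.c x - w) + ‖P.c x - w‖ ^ 2 / (2 * μ) : ℝ) : EReal)) := by
    refine le_iInf fun w => ?_
    rcases lt_or_ge (P.g w) ⊤ with hw | hw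
    · have h1 := hz.toReal_le hP.g_proper hw
      rw [norm_sub_sq_div_eq hμ, norm_sub_sq_div_eq hμ] at h1
      rw [← hP.g_proper.coe_toReal hw, ← EReal.coe_add, EReal.coe_le_coe_iff]
      linarith
    · rw [top_le_iff.1 hw, EReal.top_add_coe]
      exact le_top
  refine le_trans (le_of_eq ?_) (add_le_add_right this _)
  rw [← EReal.coe_add]
  simp only [splitLag, splitVal, add_assoc]

/-- The pair `(x, z)` produced by an iteration is approximately optimal for the joint problem. -/
theorem StandingAssumptions.splitLag_le (hP : P.StandingAssumptions) {μ ε : ℝ} (hμ : 0 < μ)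
    {x : Eu n} {y z : Eu m} (hz : IsProx μ P.g (P.c x + μ • y) z)
    (hx : P.augLag μ x y ≤ (⨅ x' : Eu n, P.augLag μ x' y) + (ε : EReal))
    (x' : Eu n) {z' : Eu m} (hz' : P.g z' < ⊤) :
    P.splitLag μ y x z ≤ P.splitLag μ y x' z' + ε := by
  have h := (hP.le_augLag hμ x y hz).trans (hx.trans
    (add_le_add_left ((iInf_le _ x').trans (hP.augLag_le μ x' y hz')) _))
  exact_mod_cast h

/-- Joint convexity of `(x, u) ↦ f x + g (c x - u)`. -/
theorem StandingAssumptions.splitVal_combo (hP : P.StandingAssumptions) (x x' : Eu n)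
    {z z' : Eu m} (hz : P.g z < ⊤) (hz' : P.g z' < ⊤) {t : ℝ} (h0 : 0 ≤ t) (h1 : t ≤ 1) :
    ∃ w, P.g w < ⊤ ∧
      P.c (t • x + (1 - t) • x') - w = t • (P.c x - z) + (1 - t) • (P.c x' - z') ∧
      P.splitVal (t • x + (1 - t) • x') w ≤
        t * P.splitVal x z + (1 - t) * P.splitVal x' z' := by
  have hle := hP.g_convex.le_combo hP.g_proper hz hz' h0 h1
  have hlt := hle.trans_lt (EReal.coe_lt_top _)
  -- The witness is the convex combination of `z` and `z'` plus the curvature defect of `c`. The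
  -- defect cannot increase `g`, and it cancels in the residual.
  have hv := (hP.c_convex x x' t h0 h1 _ hlt).trans hle
  refine ⟨_, hv.trans_lt (EReal.coe_lt_top _), ?_, ?_⟩
  · simp only [smul_sub]
    abel
  · have hf := hP.f_convex.2 (Set.mem_univ x) (Set.mem_univ x') h0 (sub_nonneg.2 h1) (by ring)
    rw [← hP.g_proper.coe_toReal (hv.trans_lt (EReal.coe_lt_top _)),
      EReal.coe_le_coe_iff] at hv
    simp only [smul_eq_mul] at hf
    simp only [splitVal]
    linarith

/-- An affine minorant of the value function that is exact at the origin is a multiplier that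
makes the minimizer stationary. -/
theorem StandingAssumptions.isStationary_of_multiplier (hP : P.StandingAssumptions) {x : Eu n}
    (hx : P.g (P.c x) < ⊤) {y : Eu m}
    (h : ∀ x' z', P.g z' < ⊤ →
      P.splitVal x (P.c x) ≤ P.splitVal x' z' + inner ℝ y (P.c x' - z')) :
    P.IsStationary x := by
  refine ⟨hx, y, ?_, ?_⟩
  · have hd : DifferentiableAt ℝ (fun x' : Eu n => P.f x' + inner ℝ y (P.c x')) x := by
      have hf := (hP.f_smooth.differentiable one_ne_zero) x
      have hc := (hP.c_smooth.differentiable one_ne_zero) x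
      exact hf.add ((differentiableAt_const y).inner ℝ hc)
    -- Fixing `z' = c x` shows that `x` minimizes the Lagrangian.
    have hmin : IsLocalMin (fun x' : Eu n => P.f x' + inner ℝ y (P.c x')) x := by
      refine Filter.Eventually.of_forall fun x' => ?_
      have := h x' (P.c x) hx
      simp only [splitVal, inner_sub_right] at this
      linarith
    rw [hasGradientAt_iff_hasFDerivAt, map_zero, ← hmin.fderiv_eq_zero]
    exact hd.hasFDerivAt
  -- Fixing `x' = x` shows that `c x` attains the supremum in the conjugate; the subgradient
  -- inequality then follows by bounding `conj P.g w` below by its term at `c x`.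
  · have hconj : conj P.g y = ((inner ℝ (P.c x) y - (P.g (P.c x)).toReal : ℝ) : EReal) := by
      refine le_antisymm (iSup_le fun z => ?_) ?_
      · rcases lt_or_ge (P.g z) ⊤ with hz | hz
        · have := h x z hz
          simp only [splitVal, inner_sub_right] at this
          rw [← hP.g_proper.coe_toReal hz, ← EReal.coe_sub, EReal.coe_le_coe_iff,
            real_inner_comm y z, real_inner_comm y (P.c x)]
          linarith
        · rw [top_le_iff.1 hz, EReal.sub_top]
          exact bot_le
      · refine le_trans (le_of_eq ?_) (le_iSup _ (P.c x))
        rw [EReal.coe_sub, hP.g_proper.coe_toReal hx]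
    refine ⟨by rw [hconj]; exact EReal.coe_ne_top _, by rw [hconj]; exact EReal.coe_ne_bot _,
      fun w => ?_⟩
    refine le_trans (le_of_eq ?_) (le_iSup _ (P.c x))
    rw [hconj, ← hP.g_proper.coe_toReal hx, ← EReal.coe_add, ← EReal.coe_sub, inner_sub_right]
    congr 1
    simp only [EReal.toReal_coe]
    ring

theorem StandingAssumptions.exists_minimizer_splitVal (hP : P.StandingAssumptions) :
    ∃ x, P.IsMinimizer x ∧ P.g (P.c x) < ⊤ ∧ P.optVal = (P.splitVal x (P.c x) : EReal) := by
  obtain ⟨x, hx⟩ := hP.exists_minimizer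
  obtain ⟨x', hx'⟩ := hP.feasible
  have hlt : P.g (P.c x) < ⊤ := by
    by_contra hn
    have h := hx x'
    rw [not_lt, top_le_iff] at hn
    rw [obj, obj, hn, EReal.coe_add_top, ← hP.coe_splitVal x' hx', top_le_iff] at h
    exact EReal.coe_ne_top _ h
  refine ⟨x, hx, hlt, ?_⟩
  rw [hP.coe_splitVal x hlt]
  exact le_antisymm (iInf_le _ x) (le_iInf hx)

theorem valueFun_zero : P.valueFun 0 = P.optVal := by
  simp [valueFun, optVal, obj]

theorem StandingAssumptions.valueFun_le (hP : P.StandingAssumptions) (x : Eu n) {z : Eu m}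
    (hz : P.g z < ⊤) : P.valueFun (P.c x - z) ≤ (P.splitVal x z : EReal) := by
  refine (iInf_le _ x).trans_eq ?_
  rw [sub_sub_cancel, hP.coe_splitVal x hz]

/-- The value function at the residual bounds the split value from below, and it is lower
semicontinuous at `0`. The points `x i` need not converge or stay bounded. -/
theorem StandingAssumptions.eventually_lt_splitVal (hP : P.StandingAssumptions)
    (hV : LowerSemicontinuous P.valueFun) {ι : Type*} {l : Filter ι} {x : ι → Eu n} {z : ι → Eu m}
    (hz : ∀ i, P.g (z i) < ⊤) (hu : Tendsto (fun i => P.c (x i) - z i) l (𝓝 0)) {a : ℝ}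
    (ha : (a : EReal) < P.optVal) : ∀ᶠ i in l, a < P.splitVal (x i) (z i) := by
  rw [← valueFun_zero] at ha
  filter_upwards [hu.eventually (hV 0 _ ha)] with i hi
  exact_mod_cast hi.trans_le (hP.valueFun_le (x i) (hz i))

end Problem

/-! ### Parameter constants -/

namespace ElasticParams

variable (D : ElasticParams m)

theorem β_pos : 0 < D.β := (sq_nonneg D.η).trans_lt D.β_mem.1

theorem β_lt_one : D.β < 1 := D.β_mem.2.trans D.η_mem.2

theorem one_lt_ratio : 1 < D.η / D.β := (one_lt_div D.β_pos).2 D.β_mem.2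

/-- This is the factor `η² / β` applied to `μ ρ²` by each shrinking update; here the lower bound on
`β` is needed. -/
theorem contraction_lt_one : D.β * (D.η / D.β) ^ 2 < 1 := by
  have h : D.β * (D.η / D.β) ^ 2 = D.η ^ 2 / D.β := by
    have := D.β_pos.ne'
    field_simp
  rw [h, div_lt_one D.β_pos]
  exact D.β_mem.1

end ElasticParams

/-! ### Invariants of the iteration and the multiplier inequality -/

namespace IsElasticALM

variable {P : Problem n m} {D : ElasticParams m} {x : ℕ → Eu n} {z y yhat : ℕ → Eu m}
  {μ ρ ε : ℕ → ℝ}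

theorem update_cases (h : IsElasticALM P D x z y yhat μ ρ ε) (k : ℕ) :
    (μ (k + 1) = μ k ∧ ρ (k + 1) = ρ k) ∨
      (μ (k + 1) = D.β * μ k ∧ ρ (k + 1) = D.η / D.β * ρ k) :=
  (em _).imp (h.update_keep k) (h.update_shrink k)

theorem μ_pos (h : IsElasticALM P D x z y yhat μ ρ ε) (k : ℕ) : 0 < μ k := by
  induction k with
  | zero => rw [h.μ_zero]; exact D.μ0_pos
  | succ k ih =>
    rcases h.update_cases k with hk | hk <;> rw [hk.1]
    · exact ih
    · exact mul_pos D.β_pos ih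

theorem one_le_ρ (h : IsElasticALM P D x z y yhat μ ρ ε) (k : ℕ) : 1 ≤ ρ k := by
  induction k with
  | zero => rw [h.ρ_zero]
  | succ k ih =>
    rcases h.update_cases k with hk | hk <;> rw [hk.2]
    · exact ih
    · nlinarith [D.one_lt_ratio]

theorem μ_antitone (h : IsElasticALM P D x z y yhat μ ρ ε) : Antitone μ := by
  refine antitone_nat_of_succ_le fun k => ?_
  rcases h.update_cases k with hk | hk <;> rw [hk.1]
  nlinarith [D.β_lt_one, h.μ_pos k]

theorem exists_norm_yhat_le (h : IsElasticALM P D x z y yhat μ ρ ε) :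
    ∃ R, 0 ≤ R ∧ ∀ k, ‖yhat k‖ ≤ R * ρ k := by
  obtain ⟨R, hR⟩ := D.Ysg_compact.isBounded.exists_norm_le
  obtain ⟨w₀, hw₀⟩ := D.Ysg_nonempty
  refine ⟨R, (norm_nonneg _).trans (hR w₀ hw₀), fun k => ?_⟩
  obtain ⟨w, hw, hwk⟩ := Set.mem_smul_set.1 (h.yhat_eq k).1
  have hρ := zero_le_one.trans (h.one_le_ρ k)
  rw [← hwk, norm_smul, Real.norm_of_nonneg hρ, mul_comm]
  exact mul_le_mul_of_nonneg_right (hR w hw) hρ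

theorem z_lt_top (h : IsElasticALM P D x z y yhat μ ρ ε) (hP : P.StandingAssumptions) (k : ℕ) :
    P.g (z k) < ⊤ := (h.z_eq k).lt_top hP.g_proper

theorem splitLag_le (h : IsElasticALM P D x z y yhat μ ρ ε) (hP : P.StandingAssumptions) (k : ℕ)
    (x' : Eu n) {z' : Eu m} (hz' : P.g z' < ⊤) :
    P.splitLag (μ k) (yhat k) (x k) (z k) ≤ P.splitLag (μ k) (yhat k) x' z' + ε k :=
  hP.splitLag_le (h.μ_pos k) (h.z_eq k) (h.x_approx k) x' hz'

/-- The updated multiplier is an approximate subgradient of the value function. -/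
theorem splitVal_le (h : IsElasticALM P D x z y yhat μ ρ ε) (hP : P.StandingAssumptions) (k : ℕ)
    {s : ℝ} (hs : 0 < s) (hμs : μ k * s ≤ 1) (hε : ε k ≤ μ k * s ^ 2)
    (x' : Eu n) {z' : Eu m} (hz' : P.g z' < ⊤) :
    P.splitVal (x k) (z k) ≤ P.splitVal x' z' +
      inner ℝ (y (k + 1)) ((P.c x' - z') - (P.c (x k) - z k)) +
      s * (‖(P.c x' - z') - (P.c (x k) - z k)‖ ^ 2 / 2 + 1) := by
  have hμ := h.μ_pos k
  refine le_of_segment_bound hμ hs hμs hε fun t h0 h1 => ?_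
  obtain ⟨w, hw, hcw, hval⟩ := hP.splitVal_combo x' (x k) hz' (h.z_lt_top hP k) h0 h1
  have hopt := h.splitLag_le hP k (t • x' + (1 - t) • x k) hw
  simp only [Problem.splitLag, hcw] at hopt
  rw [h.y_succ k]
  generalize P.c x' - z' = u' at *
  generalize P.c (x k) - z k = u at *
  -- In the expanded penalty, the term linear in `t` has slope `μ⁻¹ ⟨u, u' - u⟩`; together with
  -- `yhat` it produces exactly the updated multiplier.
  have hu : t • u' + (1 - t) • u = u + t • (u' - u) := by module
  rw [hu, norm_add_sq_real, inner_add_right, inner_smul_right, inner_smul_right, norm_smul,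
    Real.norm_of_nonneg h0] at hopt
  rw [inner_add_left, real_inner_smul_left]
  have e : (‖u‖ ^ 2 + 2 * (t * inner ℝ u (u' - u)) + (t * ‖u' - u‖) ^ 2) / (2 * μ k) =
      ‖u‖ ^ 2 / (2 * μ k) + t * ((μ k)⁻¹ * inner ℝ u (u' - u)) +
        t ^ 2 * ‖u' - u‖ ^ 2 / (2 * μ k) := by
    field_simp
  rw [e] at hopt
  linarith

theorem tendsto_ε (h : IsElasticALM P D x z y yhat μ ρ ε)
    (hsum : Summable fun k => Real.sqrt (ε k / μ k)) : Tendsto ε atTop (𝓝 0) := by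
  have h1 : Tendsto (fun k => μ 0 * Real.sqrt (ε k / μ k) ^ 2) atTop (𝓝 0) := by
    simpa using (hsum.tendsto_atTop_zero.pow 2).const_mul (μ 0)
  refine squeeze_zero h.ε_nonneg (fun k => ?_) h1
  have hμ := h.μ_pos k
  have hd : 0 ≤ ε k / μ k := div_nonneg (h.ε_nonneg k) hμ.le
  rw [Real.sq_sqrt hd]
  calc ε k = μ k * (ε k / μ k) := by field_simp
    _ ≤ μ 0 * (ε k / μ k) := mul_le_mul_of_nonneg_right (h.μ_antitone (Nat.zero_le k)) hd

/-! ### Exclusion of convergent multipliers, and its first use -/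

/-- Multipliers cannot converge along a subsequence on which the residuals vanish. -/
theorem not_tendsto_multiplier (h : IsElasticALM P D x z y yhat μ ρ ε)
    (hP : P.StandingAssumptions) (hirr : ∀ x, P.IsMinimizer x → ¬ P.IsStationary x)
    (hV : LowerSemicontinuous P.valueFun) (hsum : Summable fun k => Real.sqrt (ε k / μ k))
    {κ : ℕ → ℕ} (hκ : Tendsto κ atTop atTop)
    (hu : Tendsto (fun j => P.c (x (κ j)) - z (κ j)) atTop (𝓝 0)) (ybar : Eu m) :
    ¬ Tendsto (fun j => y (κ j + 1)) atTop (𝓝 ybar) := by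
  intro hy
  obtain ⟨xs, hmin, hxs, hopt⟩ := hP.exists_minimizer_splitVal
  refine hirr xs hmin (hP.isStationary_of_multiplier hxs (y := ybar) fun x' z' hz' => ?_)
  -- The square root secures `ε k ≤ μ k * s k ^ 2`; the second term keeps `s` positive when `ε k =
  -- 0`.
  set s : ℕ → ℝ := fun k => Real.sqrt (ε k / μ k) + 1 / ((k : ℝ) + 1) with hsdef
  have hs : Tendsto s atTop (𝓝 0) := by
    simpa only [add_zero] using hsum.tendsto_atTop_zero.add tendsto_one_div_add_atTop_nhds_zero_nat
  have hspos : ∀ k, 0 < s k := fun k =>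
    add_pos_of_nonneg_of_pos (Real.sqrt_nonneg _) (by positivity)
  have hμs : ∀ᶠ k in atTop, μ k * s k ≤ 1 := by
    have : Tendsto (fun k => μ 0 * s k) atTop (𝓝 0) := by simpa using hs.const_mul (μ 0)
    filter_upwards [this.eventually_le_const zero_lt_one] with k hk
    exact (mul_le_mul_of_nonneg_right (h.μ_antitone (Nat.zero_le k)) (hspos k).le).trans hk
  have hεs : ∀ k, ε k ≤ μ k * s k ^ 2 := fun k => by
    have hμ := h.μ_pos k
    have hd : 0 ≤ ε k / μ k := div_nonneg (h.ε_nonneg k) hμ.le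
    rw [mul_comm, ← div_le_iff₀ hμ, ← Real.sq_sqrt hd]
    exact pow_le_pow_left₀ (Real.sqrt_nonneg _) (le_add_of_nonneg_right (by positivity)) 2
  -- Only an eventual lower bound on the split values is at hand, so each level below the optimal
  -- value is passed to the limit separately.
  refine le_of_forall_lt fun a ha => ?_
  obtain ⟨a', haa', ha'⟩ := exists_between ha
  refine haa'.trans_le ?_
  have hlow := hP.eventually_lt_splitVal hV (fun j => h.z_lt_top hP (κ j)) hu (a := a')
    (by rw [hopt]; exact_mod_cast ha')
  have hd : Tendsto (fun j => (P.c x' - z') - (P.c (x (κ j)) - z (κ j))) atTop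
      (𝓝 (P.c x' - z')) := by simpa using hu.const_sub (P.c x' - z')
  have hlim : Tendsto (fun j => P.splitVal x' z' +
      inner ℝ (y (κ j + 1)) ((P.c x' - z') - (P.c (x (κ j)) - z (κ j))) +
      s (κ j) * (‖(P.c x' - z') - (P.c (x (κ j)) - z (κ j))‖ ^ 2 / 2 + 1)) atTop
      (𝓝 (P.splitVal x' z' + inner ℝ ybar (P.c x' - z'))) := by
    simpa using ((hy.inner hd).const_add (P.splitVal x' z')).add
      ((hs.comp hκ).mul (((hd.norm.pow 2).div_const 2).add_const 1))
  refine ge_of_tendsto hlim ?_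
  filter_upwards [hlow, hκ.eventually hμs] with j hj hj'
  exact hj.le.trans (h.splitVal_le hP (κ j) (hspos _) hj' (hεs _) x' hz')

theorem frequently_shrink (h : IsElasticALM P D x z y yhat μ ρ ε)
    (hP : P.StandingAssumptions) (hirr : ∀ x, P.IsMinimizer x → ¬ P.IsStationary x)
    (hV : LowerSemicontinuous P.valueFun) (hsum : Summable fun k => Real.sqrt (ε k / μ k)) :
    ∃ᶠ k in atTop, μ (k + 1) = D.β * μ k ∧ ρ (k + 1) = D.η / D.β * ρ k := by
  intro hnot
  obtain ⟨N, hN⟩ := eventually_atTop.1 hnot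
  have hkeep : ∀ k, N ≤ k → (maxNorm (P.c (x k) - z k) : EReal) ≤
      (D.θ : EReal) * prevResidual (fun j => maxNorm (P.c (x j) - z j)) k := fun k hk => by
    by_contra hc
    exact hN k hk (h.update_shrink k hc)
  have hconst : ∀ j, μ (N + j) = μ N ∧ ρ (N + j) = ρ N := fun j => by
    induction j with
    | zero => exact ⟨rfl, rfl⟩
    | succ j ih =>
      have := h.update_keep (N + j) (hkeep _ (Nat.le_add_right _ _))
      exact ⟨this.1.trans ih.1, this.2.trans ih.2⟩
  have hgeo : ∀ j, maxNorm (P.c (x (N + j)) - z (N + j)) ≤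
      D.θ ^ j * maxNorm (P.c (x N) - z N) := fun j => by
    induction j with
    | zero => simp
    | succ j ih =>
      -- The index is a successor, so the conventional residual `∞` before iteration `0` never
      -- enters, even if `N = 0`.
      have h1 := hkeep (N + j + 1) (by omega)
      simp only [prevResidual] at h1
      have h2 : maxNorm (P.c (x (N + j + 1)) - z (N + j + 1)) ≤
          D.θ * maxNorm (P.c (x (N + j)) - z (N + j)) := by exact_mod_cast h1
      rw [← add_assoc, pow_succ', mul_assoc]
      exact h2.trans (mul_le_mul_of_nonneg_left ih D.θ_mem.1.le)
  have hu : Tendsto (fun j => P.c (x (N + j)) - z (N + j)) atTop (𝓝 0) := by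
    refine tendsto_zero_of_tendsto_maxNorm (squeeze_zero (fun j => norm_nonneg _) hgeo ?_)
    simpa using (tendsto_pow_atTop_nhds_zero_of_lt_one D.θ_mem.1.le D.θ_mem.2).mul_const
      (maxNorm (P.c (x N) - z N))
  obtain ⟨B, hB⟩ := (Metric.isBounded_range_of_tendsto _ hu).exists_norm_le
  obtain ⟨R, -, hR⟩ := h.exists_norm_yhat_le
  have hbound : ∀ j, y (N + j + 1) ∈ Metric.closedBall (0 : Eu m)
      (R * ρ N + ‖(μ N)⁻¹‖ * B) := fun j => by
    rw [mem_closedBall_zero_iff, h.y_succ, (hconst j).1]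
    refine (norm_add_le _ _).trans (add_le_add ?_ ?_)
    · rw [← (hconst j).2]
      exact hR _
    · rw [norm_smul]
      exact mul_le_mul_of_nonneg_left (hB _ ⟨j, rfl⟩) (norm_nonneg _)
  obtain ⟨ybar, -, φ, hφ, hlim⟩ := (isCompact_closedBall _ _).tendsto_subseq hbound
  exact h.not_tendsto_multiplier hP hirr hV hsum (κ := fun j => N + φ j)
    (tendsto_atTop_mono (fun j => Nat.le_add_left _ _) hφ.tendsto_atTop)
    (hu.comp hφ.tendsto_atTop) ybar hlim

/-! ### Vanishing residuals, divergent multipliers, convergent values -/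

theorem tendsto_μ_mul_ρ_sq (h : IsElasticALM P D x z y yhat μ ρ ε)
    (hfreq : ∃ᶠ k in atTop, μ (k + 1) = D.β * μ k ∧ ρ (k + 1) = D.η / D.β * ρ k) :
    Tendsto (fun k => μ k * ρ k ^ 2) atTop (𝓝 0) := by
  have hnn : ∀ k, 0 ≤ μ k * ρ k ^ 2 := fun k => mul_nonneg (h.μ_pos k).le (sq_nonneg _)
  have hstep : ∀ k, μ (k + 1) = D.β * μ k ∧ ρ (k + 1) = D.η / D.β * ρ k →
      μ (k + 1) * ρ (k + 1) ^ 2 = D.β * (D.η / D.β) ^ 2 * (μ k * ρ k ^ 2) := fun k hk => by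
    rw [hk.1, hk.2]
    ring
  refine tendsto_zero_of_antitone_of_frequently_mul hnn D.contraction_lt_one
    (antitone_nat_of_succ_le fun k => ?_) (hfreq.mono fun k hk => (hstep k hk).le)
  rcases h.update_cases k with hk | hk
  · rw [hk.1, hk.2]
  · rw [hstep k hk]
    exact mul_le_of_le_one_left (hnn k) D.contraction_lt_one.le

/-- No lower bound on `f x + g z` is available a priori. Approximate optimality of iteration `0`
supplies one that is quadratic in the residual with weight `1 / (2 μ 0)`, which the penalty of
iteration `k` outweighs once `μ k` is small. -/
theorem tendsto_residual (h : IsElasticALM P D x z y yhat μ ρ ε)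
    (hP : P.StandingAssumptions) (hsum : Summable fun k => Real.sqrt (ε k / μ k))
    (hq : Tendsto (fun k => μ k * ρ k ^ 2) atTop (𝓝 0)) :
    Tendsto (fun k => P.c (x k) - z k) atTop (𝓝 0) := by
  obtain ⟨xs, -, hxs, -⟩ := hP.exists_minimizer_splitVal
  obtain ⟨R, hR0, hR⟩ := h.exists_norm_yhat_le
  have hμ : Tendsto μ atTop (𝓝 0) := by
    refine squeeze_zero (fun k => (h.μ_pos k).le) (fun k => ?_) hq
    exact le_mul_of_one_le_right (h.μ_pos k).le (one_le_pow₀ (h.one_le_ρ k))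
  have hyhat : Tendsto (fun k => μ k * ‖yhat k‖) atTop (𝓝 0) := by
    refine squeeze_zero (fun k => mul_nonneg (h.μ_pos k).le (norm_nonneg _)) (fun k => ?_)
      (by simpa using hq.const_mul R)
    have h1 : ρ k ≤ ρ k ^ 2 := le_self_pow₀ (h.one_le_ρ k) two_ne_zero
    calc μ k * ‖yhat k‖ ≤ μ k * (R * ρ k ^ 2) :=
          mul_le_mul_of_nonneg_left ((hR k).trans (mul_le_mul_of_nonneg_left h1 hR0))
            (h.μ_pos k).le
      _ = R * (μ k * ρ k ^ 2) := by ring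
  set φ := P.splitVal xs (P.c xs)
  set m₀ := P.splitLag (μ 0) (yhat 0) (x 0) (z 0) - ε 0 with hm₀
  -- The coefficients in `u² ≤ a + b u` for the residual norm `u`, obtained after multiplying by `4
  -- μ k`.
  set a : ℕ → ℝ := fun k => 4 * (μ k * (φ + ε k - m₀)) with ha
  set b : ℕ → ℝ := fun k => 4 * (μ k * ‖yhat k‖ + μ k * ‖yhat 0‖) with hb
  have hlim : Tendsto (fun k => 2 * a k + b k ^ 2) atTop (𝓝 0) := by
    have h1 : Tendsto a atTop (𝓝 0) := by
      simpa using (hμ.mul (((h.tendsto_ε hsum).const_add φ).sub_const m₀)).const_mul 4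
    have h2 : Tendsto b atTop (𝓝 0) := by
      simpa using (hyhat.add (hμ.mul_const ‖yhat 0‖)).const_mul 4
    simpa using (h1.const_mul 2).add (h2.pow 2)
  have hsq : Tendsto (fun k => ‖P.c (x k) - z k‖ ^ 2) atTop (𝓝 0) := by
    refine squeeze_zero' (Eventually.of_forall fun k => sq_nonneg _) ?_ hlim
    -- With `μ k ≤ μ 0 / 2`, at least half of the penalty of iteration `k` survives the subtraction.
    filter_upwards [hμ.eventually_le_const (half_pos (h.μ_pos 0))] with k hk
    have hup := h.splitLag_le hP k xs hxs
    have hlow := h.splitLag_le hP 0 (x k) (h.z_lt_top hP k)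
    rw [Problem.splitLag, Problem.splitLag, sub_self, inner_zero_right,
      norm_zero] at hup
    rw [Problem.splitLag.eq_def P _ _ (x k)] at hlow
    have hμk := h.μ_pos k
    have hμ0 := h.μ_pos 0
    have hi1 := abs_le.1 (abs_real_inner_le_norm (yhat k) (P.c (x k) - z k))
    have hi2 := abs_le.1 (abs_real_inner_le_norm (yhat 0) (P.c (x k) - z k))
    generalize ‖P.c (x k) - z k‖ = u at *
    have hdiff : u ^ 2 / (2 * μ k) - u ^ 2 / (2 * μ 0) ≤
        φ + ε k - m₀ + (‖yhat k‖ + ‖yhat 0‖) * u := by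
      have : (0 : ℝ) ^ 2 / (2 * μ k) = 0 := by simp
      rw [this] at hup
      linarith [hi1.1, hi2.2]
    have hquart : u ^ 2 / (4 * μ k) ≤ u ^ 2 / (2 * μ k) - u ^ 2 / (2 * μ 0) := by
      have : u ^ 2 / (2 * μ 0) ≤ u ^ 2 / (4 * μ k) :=
        div_le_div_of_nonneg_left (sq_nonneg u) (by positivity) (by linarith)
      have e : u ^ 2 / (2 * μ k) = u ^ 2 / (4 * μ k) + u ^ 2 / (4 * μ k) := by
        field_simp
        ring
      linarith
    have hmain := (div_le_iff₀ (by positivity : 0 < 4 * μ k)).1 (hquart.trans hdiff)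
    have hab : u ^ 2 ≤ a k + b k * u := by
      simp only [ha, hb]
      linarith
    -- Absorb `b u ≤ (u² + b²) / 2` into the left side.
    nlinarith [sq_nonneg (u - b k)]
  have hn : Tendsto (fun k => ‖P.c (x k) - z k‖) atTop (𝓝 0) := by
    simpa [Real.sqrt_sq (norm_nonneg _)] using hsq.sqrt
  exact tendsto_zero_iff_norm_tendsto_zero.2 hn

theorem tendsto_norm_multiplier (h : IsElasticALM P D x z y yhat μ ρ ε)
    (hP : P.StandingAssumptions) (hirr : ∀ x, P.IsMinimizer x → ¬ P.IsStationary x)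
    (hV : LowerSemicontinuous P.valueFun) (hsum : Summable fun k => Real.sqrt (ε k / μ k))
    (hu : Tendsto (fun k => P.c (x k) - z k) atTop (𝓝 0)) :
    Tendsto (fun k => ‖y k‖) atTop atTop := by
  -- The shift matches the multiplier `y (k + 1)` with the residual of iteration `k`.
  rw [← tendsto_add_atTop_iff_nat 1, tendsto_atTop]
  intro B
  by_contra hB
  obtain ⟨κ, hκ, hyB⟩ := extraction_of_frequently_atTop (not_eventually.1 hB)
  obtain ⟨ybar, -, φ, hφ, hlim⟩ := (isCompact_closedBall (0 : Eu m) B).tendsto_subseq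
    (x := fun j => y (κ j + 1))
    fun j => mem_closedBall_zero_iff.2 (not_le.1 (hyB j)).le
  have hκφ : Tendsto (κ ∘ φ) atTop atTop := hκ.tendsto_atTop.comp hφ.tendsto_atTop
  exact h.not_tendsto_multiplier hP hirr hV hsum hκφ (hu.comp hκφ) ybar hlim

/-- Compare with the pair `(xs, c xs)`, whose residual is zero; completing the square shows that the
multiplier and penalty terms at iteration `k` are at least `-μ ‖yhat‖² / 2`. -/
theorem splitVal_le_optimal (h : IsElasticALM P D x z y yhat μ ρ ε)
    (hP : P.StandingAssumptions) {xs : Eu n} (hxs : P.g (P.c xs) < ⊤) (k : ℕ) :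
    P.splitVal (x k) (z k) ≤ P.splitVal xs (P.c xs) + ε k + μ k * ‖yhat k‖ ^ 2 / 2 := by
  have hup := h.splitLag_le hP k xs hxs
  have hsq := Problem.norm_sub_sq_div_eq (h.μ_pos k) (P.c (x k)) (yhat k) (z k)
  have hnn : 0 ≤ ‖z k - (P.c (x k) + μ k • yhat k)‖ ^ 2 / (2 * μ k) :=
    div_nonneg (sq_nonneg _) (by linarith [h.μ_pos k])
  rw [Problem.splitLag, Problem.splitLag, sub_self, inner_zero_right, norm_zero] at hup
  have h0 : (0 : ℝ) ^ 2 / (2 * μ k) = 0 := by simp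
  rw [h0] at hup
  linarith

theorem tendsto_splitVal (h : IsElasticALM P D x z y yhat μ ρ ε)
    (hP : P.StandingAssumptions) (hV : LowerSemicontinuous P.valueFun)
    (hsum : Summable fun k => Real.sqrt (ε k / μ k))
    (hq : Tendsto (fun k => μ k * ρ k ^ 2) atTop (𝓝 0))
    (hu : Tendsto (fun k => P.c (x k) - z k) atTop (𝓝 0)) :
    Tendsto (fun k => (P.f (x k) : EReal) + P.g (z k)) atTop (𝓝 P.optVal) := by
  obtain ⟨xs, -, hxs, hopt⟩ := hP.exists_minimizer_splitVal
  obtain ⟨R, hR0, hR⟩ := h.exists_norm_yhat_le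
  simp_rw [← fun k => hP.coe_splitVal (x k) (h.z_lt_top hP k)]
  rw [hopt, EReal.tendsto_coe]
  have hbound : Tendsto (fun k => P.splitVal xs (P.c xs) + ε k + R ^ 2 * (μ k * ρ k ^ 2) / 2)
      atTop (𝓝 (P.splitVal xs (P.c xs))) := by
    simpa using ((h.tendsto_ε hsum).const_add _).add ((hq.const_mul (R ^ 2)).div_const 2)
  refine tendsto_order.2 ⟨fun a ha => ?_, fun a ha => ?_⟩
  · exact hP.eventually_lt_splitVal hV (h.z_lt_top hP) hu (by rw [hopt]; exact_mod_cast ha)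
  · filter_upwards [hbound.eventually_lt_const ha] with k hk
    refine ((h.splitVal_le_optimal hP hxs k).trans ?_).trans_lt hk
    have h1 : ‖yhat k‖ ^ 2 ≤ (R * ρ k) ^ 2 := pow_le_pow_left₀ (norm_nonneg _) (hR k) 2
    nlinarith [mul_le_mul_of_nonneg_left h1 (h.μ_pos k).le]

end IsElasticALM

/-! ### Accumulation points and conclusion -/

theorem Problem.StandingAssumptions.isMinimizer_of_tendsto {P : Problem n m}
    (hP : P.StandingAssumptions) {x : ℕ → Eu n} {z : ℕ → Eu m} {xbar : Eu n}
    (hx : Tendsto x atTop (𝓝 xbar)) (hz : Tendsto z atTop (𝓝 (P.c xbar)))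
    (hval : Tendsto (fun k => (P.f (x k) : EReal) + P.g (z k)) atTop (𝓝 P.optVal)) :
    P.IsMinimizer xbar := by
  have hf : LowerSemicontinuous fun p : Eu n × Eu m => (P.f p.1 : EReal) :=
    (continuous_coe_real_ereal.comp (hP.f_smooth.continuous.comp continuous_fst)).lowerSemicontinuous
  have hg : LowerSemicontinuous fun p : Eu n × Eu m => P.g p.2 :=
    LowerSemicontinuous.comp hP.g_lsc continuous_snd
  have hlsc : LowerSemicontinuousAt (fun p : Eu n × Eu m => (P.f p.1 : EReal) + P.g p.2)
      (xbar, P.c xbar) :=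
    LowerSemicontinuousAt.add' (hf _) (hg _) (EReal.continuousAt_add (Or.inl (EReal.coe_ne_top _))
      (Or.inl (EReal.coe_ne_bot _)))
  have hle : P.obj xbar ≤ P.optVal := by
    refine le_of_forall_lt fun a ha => ?_
    obtain ⟨a', haa', ha'⟩ := exists_between ha
    refine haa'.trans_le (ge_of_tendsto hval ?_)
    filter_upwards [(hx.prodMk_nhds hz).eventually (hlsc a' ha')] with k hk
    exact hk.le
  exact fun x' => hle.trans (iInf_le _ x')

end ConvexComposite

theorem theorem6p3 {n m : ℕ} (P : ConvexComposite.Problem n m)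
    (hP : P.StandingAssumptions)
    (hirr : ∀ x, P.IsMinimizer x → ¬ P.IsStationary x)
    (hV_proper : ConvexComposite.Proper P.valueFun)
    (hV_lsc : LowerSemicontinuous P.valueFun)
    (D : ConvexComposite.ElasticParams m)
    (x : ℕ → ConvexComposite.Eu n) (z y yhat : ℕ → ConvexComposite.Eu m)
    (μ ρ ε : ℕ → ℝ)
    (halg : ConvexComposite.IsElasticALM P D x z y yhat μ ρ ε)
    (hsum : Summable (fun k => Real.sqrt (ε k / μ k))) :
    Tendsto (fun k => ‖y k‖) atTop atTop ∧
    limsup (fun k => (P.f (x k) : EReal) + P.g (z k)) atTop ≤ P.optVal ∧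
    (∀ xbar : ConvexComposite.Eu n, MapClusterPt xbar atTop x → P.IsMinimizer xbar) ∧
    (∀ (xbar : ConvexComposite.Eu n) (κ : ℕ → ℕ), StrictMono κ →
      Tendsto (fun j => x (κ j)) atTop (𝓝 xbar) →
        Tendsto (fun j => z (κ j)) atTop (𝓝 (P.c xbar)) ∧
        Tendsto (fun j => (P.f (x (κ j)) : EReal) + P.g (z (κ j))) atTop (𝓝 P.optVal)) := by
  have hq := halg.tendsto_μ_mul_ρ_sq (halg.frequently_shrink hP hirr hV_lsc hsum)
  have hu := halg.tendsto_residual hP hsum hq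
  have hval := halg.tendsto_splitVal hP hV_lsc hsum hq hu
  have hsub : ∀ (xbar : ConvexComposite.Eu n) (κ : ℕ → ℕ), StrictMono κ →
      Tendsto (fun j => x (κ j)) atTop (𝓝 xbar) →
        Tendsto (fun j => z (κ j)) atTop (𝓝 (P.c xbar)) ∧
        Tendsto (fun j => (P.f (x (κ j)) : EReal) + P.g (z (κ j))) atTop (𝓝 P.optVal) := by
    intro xbar κ hκ hx
    refine ⟨?_, hval.comp hκ.tendsto_atTop⟩
    simpa using ((hP.c_smooth.continuous.tendsto xbar).comp hx).sub (hu.comp hκ.tendsto_atTop)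
  refine ⟨halg.tendsto_norm_multiplier hP hirr hV_lsc hsum hu, hval.limsup_eq.le,
    fun xbar hx => ?_, hsub⟩
  obtain ⟨κ, hκ, hlim⟩ := hx.tendsto_subseq
  obtain ⟨h1, h2⟩ := hsub xbar κ hκ hlim
  exact hP.isMinimizer_of_tendsto hlim h1 h2
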